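/- Let $q\ge 1$ be an integer. For $N\ge 1$ and $x\in\mathbb{C}^N\setminus\{0\}$ define the inverse participation ratio of order $q$ by $$\mathrm{IPR}_q(x)=\frac{N^{q-1}\,|x|_{2q}^{2q}}{|x|_2^{2q}},$$ where $|\cdot|_p$ denotes the $p$-norm on $\mathbb{C}^N$. For every $N\ge 2$ let $O^{(N)}$ be a random matrix distributed according to the normalized Haar measure on the orthogonal group $O_N(\mathbb{R})$, all these matrices being defined on one common probability space, with an arbitrary joint distribution, and let $O_1^{(N)},O_2^{(N)}\in\mathbb{R}^N$ be the first two columns of $O^{(N)}$. Let $X,Y$ be independent standard real Gaussian random variables, and let $s,t$ be fixed real numbers with $s^2+t^2=1$. Then $\mathbf{E}\big[|tX+isY|^{2q}\big]<\infty$ and, almost surely, $$\lim_{N\to\infty}\mathrm{IPR}_q\big(tO_2^{(N)}+isO_1^{(N)}\big)=\mathbf{E}\big[|tX+isY|^{2q}\big].$$ -/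

import Mathlib

open MeasureTheory ProbabilityTheory Filter Topology
open scoped ENNReal

/-- The inverse participation ratio of order `q` of a vector `x ∈ ℂᴺ`,
`IPR_q(x) = N^(q-1) |x|_{2q}^{2q} / |x|_2^{2q}`, with `|·|_p` the `p`-norm on `ℂᴺ`
(for an integer `q ≥ 1`). -/
noncomputable def inverseParticipationRatio (q : ℕ) {N : ℕ} (x : Fin N → ℂ) : ℝ :=
  (N : ℝ) ^ (q - 1) * ‖WithLp.toLp ((2 * q : ℕ) : ℝ≥0∞) x‖ ^ (2 * q)
    / ‖WithLp.toLp (2 : ℝ≥0∞) x‖ ^ (2 * q)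

/-- The Borel `σ`-algebra on the orthogonal group `O_N(ℝ)`, which carries the topology
of a subspace of the `N × N` matrices. -/
instance orthogonalGroupMeasurableSpace (N : ℕ) :
    MeasurableSpace (Matrix.orthogonalGroup (Fin N) ℝ) :=
  borel _

instance orthogonalGroupBorelSpace (N : ℕ) :
    BorelSpace (Matrix.orthogonalGroup (Fin N) ℝ) :=
  ⟨rfl⟩

/-- `O` is a Haar distributed random orthogonal matrix: its law is a Haar measure on the group
`O_N(ℝ)` (the normalized one, whenever `P` is a probability measure). -/
structure IsHaarOrthogonal {Ω : Type*} [MeasurableSpace Ω] (P : Measure Ω) {N : ℕ}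
    (O : Ω → Matrix.orthogonalGroup (Fin N) ℝ) : Prop where
  aemeasurable : AEMeasurable O P
  isHaarMeasure : (P.map O).IsHaarMeasure

/-- The vector `t O₂ + i s O₁ ∈ ℂᴺ`, with `N = n + 2`, where `O₁`, `O₂` are the first
two columns of the matrix `O`. -/
noncomputable def columnCombination {n : ℕ} (s t : ℝ)
    (O : Matrix.orthogonalGroup (Fin (n + 2)) ℝ) : Fin (n + 2) → ℂ :=
  fun j => (t : ℂ) * ((O.1 j 1 : ℝ) : ℂ) + Complex.I * (s : ℂ) * ((O.1 j 0 : ℝ) : ℂ)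

/-! The columns `O₁`, `O₂` are unit vectors and `t ^ 2 + s ^ 2 = 1`, so the denominator of the ratio
is 1 and the ratio equals `N ^ (q - 1) * ∑ (t² v_j² + s² u_j²) ^ q` with `u = O₁`, `v = O₂`. By
rotation invariance, `(u, v)` can be compared with the Gram–Schmidt orthonormalization of two
independent standard Gaussian vectors `g`, `h`. For such a pair the sum is a function of finitely
many empirical moments `N⁻¹ ∑ g_j ^ a h_j ^ b`. It is continuous at the Gaussian moments, where its
value is the expectation sought (`orthonormalizedMean_gaussianMoment`).

The coupling between different `N` is arbitrary, so almost sure convergence has to come from the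
marginal laws alone, by Borel–Cantelli. Chebyshev's inequality gives only deviation probabilities
`O(1/N)`; the fourth-moment bound `integral_sum_pow_four_le` gives the summable rate `O(1/N²)`.

Only upper bounds on Haar probabilities are needed. The one-sided comparison
`haar_measure_columns_le` therefore suffices: degenerate Gaussian pairs are added to the event, and
need not be shown to be negligible. -/

/-! ### Fourth moments of sums of independent centred variables -/

section FourthMoment

variable {Ω : Type*} [MeasurableSpace Ω] {μ : Measure Ω} [IsProbabilityMeasure μ]

theorem integrable_pow_of_integrable_pow_four {X : Ω → ℝ} (hX : AEStronglyMeasurable X μ)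
    (h4 : Integrable (fun ω => X ω ^ 4) μ) {k : ℕ} (hk : k ≤ 4) :
    Integrable (fun ω => X ω ^ k) μ := by
  -- Domination by `|x| ^ k ≤ 1 + x ^ 4`.
  refine ((integrable_const (1 : ℝ)).add h4).mono (hX.pow k) (ae_of_all _ fun ω => ?_)
  have h0 : (0 : ℝ) ≤ X ω ^ 4 := by positivity
  simp only [Pi.add_apply, norm_pow, Real.norm_eq_abs]
  rw [abs_of_nonneg (by linarith : (0 : ℝ) ≤ 1 + X ω ^ 4), ← (by decide : Even 4).pow_abs (X ω)]
  rcases le_total |X ω| 1 with h | h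
  · linarith [pow_le_one₀ (n := k) (abs_nonneg (X ω)) h, pow_nonneg (abs_nonneg (X ω)) 4]
  · linarith [pow_le_pow_right₀ h hk]

theorem integral_add_pow_two_of_indepFun {S X : Ω → ℝ} (hind : IndepFun S X μ)
    (hS : AEMeasurable S μ) (hX : AEMeasurable X μ)
    (hS4 : Integrable (fun ω => S ω ^ 4) μ) (hX4 : Integrable (fun ω => X ω ^ 4) μ)
    (hX0 : ∫ ω, X ω ∂μ = 0) :
    ∫ ω, (S ω + X ω) ^ 2 ∂μ = ∫ ω, S ω ^ 2 ∂μ + ∫ ω, X ω ^ 2 ∂μ := by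
  have iS := fun k (hk : k ≤ 4) =>
    integrable_pow_of_integrable_pow_four hS.aestronglyMeasurable hS4 hk
  have iX := fun k (hk : k ≤ 4) =>
    integrable_pow_of_integrable_pow_four hX.aestronglyMeasurable hX4 hk
  have hi : Integrable (fun ω => S ω * X ω) μ := by
    have := hind.integrable_mul (by simpa using iS 1 (by simp)) (by simpa using iX 1 (by simp))
    exact this
  have h1 : ∫ ω, S ω * X ω ∂μ = 0 := by
    have := hind.integral_mul_eq_mul_integral hS.aestronglyMeasurable hX.aestronglyMeasurable
    simpa [hX0] using this
  have hexp : ∀ ω, (S ω + X ω) ^ 2 = (S ω ^ 2 + X ω ^ 2) + 2 * (S ω * X ω) := fun ω => by ring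
  simp_rw [hexp]
  rw [integral_add ((iS 2 (by simp)).fun_add (iX 2 (by simp))) (hi.const_mul 2),
    integral_add (iS 2 (by simp)) (iX 2 (by simp)), integral_const_mul, h1]
  ring

/-- In the binomial expansion the terms `S X³` and `S³ X` have mean zero by independence and
centring; only the even cross term survives. -/
theorem integrable_and_integral_add_pow_four_of_indepFun {S X : Ω → ℝ} (hind : IndepFun S X μ)
    (hS : AEMeasurable S μ) (hX : AEMeasurable X μ)
    (hS4 : Integrable (fun ω => S ω ^ 4) μ) (hX4 : Integrable (fun ω => X ω ^ 4) μ)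
    (hS0 : ∫ ω, S ω ∂μ = 0) (hX0 : ∫ ω, X ω ∂μ = 0) :
    Integrable (fun ω => (S ω + X ω) ^ 4) μ ∧
    ∫ ω, (S ω + X ω) ^ 4 ∂μ = ∫ ω, S ω ^ 4 ∂μ + ∫ ω, X ω ^ 4 ∂μ
      + 6 * ((∫ ω, S ω ^ 2 ∂μ) * ∫ ω, X ω ^ 2 ∂μ) := by
  have iS := fun k (hk : k ≤ 4) =>
    integrable_pow_of_integrable_pow_four hS.aestronglyMeasurable hS4 hk
  have iX := fun k (hk : k ≤ 4) =>
    integrable_pow_of_integrable_pow_four hX.aestronglyMeasurable hX4 hk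
  have hind' : ∀ a b : ℕ, IndepFun (fun ω => S ω ^ a) (fun ω => X ω ^ b) μ := fun a b =>
    hind.comp (φ := fun x => x ^ a) (ψ := fun x => x ^ b) (by fun_prop) (by fun_prop)
  have hi : ∀ a b : ℕ, a ≤ 4 → b ≤ 4 → Integrable (fun ω => S ω ^ a * X ω ^ b) μ :=
    fun a b ha hb => (hind' a b).integrable_mul (iS a ha) (iX b hb)
  have h1 : ∀ a b : ℕ, ∫ ω, S ω ^ a * X ω ^ b ∂μ = (∫ ω, S ω ^ a ∂μ) * ∫ ω, X ω ^ b ∂μ :=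
    fun a b => (hind' a b).integral_mul_eq_mul_integral (hS.pow_const a).aestronglyMeasurable
      (hX.pow_const b).aestronglyMeasurable
  have hexp : ∀ ω, (S ω + X ω) ^ 4 = (((S ω ^ 4 + X ω ^ 4) + 6 * (S ω ^ 2 * X ω ^ 2))
      + 4 * (S ω ^ 1 * X ω ^ 3)) + 4 * (S ω ^ 3 * X ω ^ 1) := fun ω => by ring
  have j1 := (iS 4 (by simp)).fun_add (iX 4 (by simp))
  have j2 := j1.fun_add ((hi 2 2 (by simp) (by simp)).const_mul 6)
  have j3 := j2.fun_add ((hi 1 3 (by simp) (by simp)).const_mul 4)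
  have j4 := (hi 3 1 (by simp) (by simp)).const_mul 4
  simp_rw [hexp]
  refine ⟨j3.fun_add j4, ?_⟩
  rw [integral_add j3 j4, integral_add j2 ((hi 1 3 (by simp) (by simp)).const_mul 4),
    integral_add j1 ((hi 2 2 (by simp) (by simp)).const_mul 6),
    integral_add (iS 4 (by simp)) (iX 4 (by simp)), integral_const_mul, integral_const_mul,
    integral_const_mul, h1, h1, h1]
  simp [hX0, hS0]

/-- The fourth moment of a sum of independent centred variables grows at most quadratically. -/
theorem integral_sum_pow_four_le {ι : Type*} {X : ι → Ω → ℝ} (hind : iIndepFun X μ)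
    (hX : ∀ i, AEMeasurable (X i) μ) (hX4 : ∀ i, Integrable (fun ω => X i ω ^ 4) μ)
    (hX0 : ∀ i, ∫ ω, X i ω ∂μ = 0) {σ κ : ℝ} (hσ0 : 0 ≤ σ) (hσ : ∀ i, ∫ ω, X i ω ^ 2 ∂μ ≤ σ)
    (hκ : ∀ i, ∫ ω, X i ω ^ 4 ∂μ ≤ κ) (s : Finset ι) :
    Integrable (fun ω => (∑ i ∈ s, X i ω) ^ 4) μ ∧
      ∫ ω, (∑ i ∈ s, X i ω) ^ 4 ∂μ ≤ κ * s.card + 3 * σ ^ 2 * (s.card : ℝ) ^ 2 := by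
  classical
  have hint : ∀ i, Integrable (X i) μ := fun i => by
    simpa using integrable_pow_of_integrable_pow_four (hX i).aestronglyMeasurable (hX4 i)
      (k := 1) (by simp)
  -- The induction also carries the second moment, which enters the cross term of the fourth.
  suffices h : Integrable (fun ω => (∑ i ∈ s, X i ω) ^ 4) μ ∧
      (∫ ω, (∑ i ∈ s, X i ω) ^ 2 ∂μ ≤ σ * s.card) ∧
      ∫ ω, (∑ i ∈ s, X i ω) ^ 4 ∂μ ≤ κ * s.card + 3 * σ ^ 2 * (s.card : ℝ) ^ 2 from
    ⟨h.1, h.2.2⟩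
  induction s using Finset.induction_on with
  | empty => simp
  | insert a s ha ih =>
    obtain ⟨ih1, ih2, ih3⟩ := ih
    have hSX : IndepFun (fun ω => ∑ i ∈ s, X i ω) (X a) μ := by
      have := hind.indepFun_finsetSum_of_notMem₀ hX ha
      convert this using 1
      ext ω
      simp
    have hS : AEMeasurable (fun ω => ∑ i ∈ s, X i ω) μ :=
      Finset.aemeasurable_fun_sum s fun i _ => hX i
    have hS0 : ∫ ω, ∑ i ∈ s, X i ω ∂μ = 0 := by
      rw [integral_finsetSum s fun i _ => hint i]
      simp [hX0]
    have e2 := integral_add_pow_two_of_indepFun hSX hS (hX a) ih1 (hX4 a) (hX0 a)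
    have e4 := integrable_and_integral_add_pow_four_of_indepFun hSX hS (hX a) ih1 (hX4 a) hS0
      (hX0 a)
    simp_rw [Finset.sum_insert ha, add_comm (X a _), Finset.card_insert_of_notMem ha]
    push_cast
    refine ⟨e4.1, ?_, ?_⟩
    · rw [e2]
      linarith [hσ a]
    · rw [e4.2]
      have : (∫ ω, (∑ i ∈ s, X i ω) ^ 2 ∂μ) * ∫ ω, X a ω ^ 2 ∂μ ≤ (σ * s.card) * σ :=
        mul_le_mul ih2 (hσ a) (integral_nonneg fun ω => by positivity) (by positivity)
      -- With `m = s.card`, the cross term `6σ²m` fits into `3σ²((m + 1)² - m²) = 3σ²(2m + 1)`.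
      nlinarith [hκ a, sq_nonneg σ]

end FourthMoment

/-! ### Deviation of empirical means -/

section EmpiricalMean

variable {E : Type*} [MeasurableSpace E] {ρ : Measure E} [IsProbabilityMeasure ρ]

/-- Quantitative law of large numbers: the deviation probabilities of empirical means are
`O(n⁻²)`. -/
theorem exists_measure_empiricalMean_deviation_le {f : E → ℝ} (hf : AEMeasurable f ρ)
    (hf4 : Integrable (fun x => f x ^ 4) ρ) {ε : ℝ} (hε : 0 < ε) :
    ∃ C : ℝ, ∀ n : ℕ, 0 < n →
      Measure.pi (fun _ : Fin n => ρ) {x | ε ≤ |(∑ j, f (x j)) / n - ∫ y, f y ∂ρ|}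
        ≤ ENNReal.ofReal (C / (n : ℝ) ^ 2) := by
  set m := ∫ y, f y ∂ρ with hm
  set g : E → ℝ := fun x => f x - m with hg
  have hfi : ∀ k ≤ 4, Integrable (fun x => f x ^ k) ρ := fun k hk =>
    integrable_pow_of_integrable_pow_four hf.aestronglyMeasurable hf4 hk
  have hgm : AEMeasurable g ρ := hf.sub_const m
  have hg4 : Integrable (fun x => g x ^ 4) ρ := by
    have : (fun x => g x ^ 4) = fun x => f x ^ 4 + (-4 * m) * f x ^ 3 + (6 * m ^ 2) * f x ^ 2
        + (-4 * m ^ 3) * f x ^ 1 + m ^ 4 := by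
      ext x
      simp only [hg]
      ring
    rw [this]
    exact ((((hfi 4 le_rfl).add ((hfi 3 (by simp)).const_mul _)).add
      ((hfi 2 (by simp)).const_mul _)).add ((hfi 1 (by simp)).const_mul _)).add
      (integrable_const _)
  have hg0 : ∫ x, g x ∂ρ = 0 := by
    simp only [hg]
    rw [integral_sub (by simpa using hfi 1 (by simp)) (integrable_const _)]
    simp [hm]
  set σ := ∫ x, g x ^ 2 ∂ρ with hσ
  set κ := ∫ x, g x ^ 4 ∂ρ with hκ
  have hσ0 : 0 ≤ σ := integral_nonneg fun x => by positivity
  have hκ0 : 0 ≤ κ := integral_nonneg fun x => by positivity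
  -- Markov's inequality for the fourth power at level `(εn)⁴`, together with `κn + 3σ²n² ≤ (κ +
  -- 3σ²)n²` for `n ≥ 1`.
  refine ⟨(κ + 3 * σ ^ 2) / ε ^ 4, fun n hn => ?_⟩
  set μ := Measure.pi (fun _ : Fin n => ρ)
  have hcomp : ∀ {h : E → ℝ} (_ : AEMeasurable h ρ) (i : Fin n),
      ∫ x, h (x i) ∂μ = ∫ y, h y ∂ρ := fun {h} hh i => by
    have hp := measurePreserving_eval (fun _ : Fin n => ρ) i
    have := integral_map (μ := μ) (φ := Function.eval i) hp.measurable.aemeasurable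
      (f := h) (by rw [hp.map_eq]; exact hh.aestronglyMeasurable)
    rw [hp.map_eq] at this
    exact this.symm
  have hcompi : ∀ {h : E → ℝ} (_ : Integrable h ρ) (i : Fin n),
      Integrable (fun x => h (x i)) μ := fun {h} hh i =>
    (measurePreserving_eval (fun _ : Fin n => ρ) i).integrable_comp_of_integrable hh
  obtain ⟨hS4, hS4le⟩ := integral_sum_pow_four_le (μ := μ)
    (X := fun (i : Fin n) (x : Fin n → E) => g (x i))
    (iIndepFun_pi fun _ => hgm)
    (fun i => hgm.comp_quasiMeasurePreserving (Measure.quasiMeasurePreserving_eval _ i))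
    (fun i => hcompi hg4 i) (fun i => (hcomp hgm i).trans hg0) hσ0
    (fun i => (hcomp (hgm.pow_const 2) i).le) (fun i => (hcomp (hgm.pow_const 4) i).le)
    Finset.univ
  have hnR : (1 : ℝ) ≤ n := by exact_mod_cast hn
  have hsub : {x : Fin n → E | ε ≤ |(∑ j, f (x j)) / n - m|} ⊆
      {x | (ε * n) ^ 4 ≤ (∑ i, g (x i)) ^ 4} := fun x hx => by
    have h1 : ∑ i, g (x i) = ((∑ j, f (x j)) / n - m) * n := by
      simp only [hg, Finset.sum_sub_distrib, Finset.sum_const, Finset.card_univ, Fintype.card_fin,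
        nsmul_eq_mul]
      field_simp
    simp only [Set.mem_ofPred_eq] at hx ⊢
    rw [h1, mul_pow, mul_pow, ← (by decide : Even 4).pow_abs (_ - m)]
    gcongr
  have hmk := mul_meas_ge_le_integral_of_nonneg (μ := μ)
    (ae_of_all _ fun x => by positivity) hS4 ((ε * n) ^ 4)
  refine (measure_mono hsub).trans ?_
  rw [← ofReal_measureReal]
  refine ENNReal.ofReal_le_ofReal ?_
  simp only [Finset.card_univ, Fintype.card_fin] at hS4le
  rw [div_div, le_div_iff₀ (by positivity)]
  have hn2 : (0 : ℝ) < (n : ℝ) ^ 2 := by positivity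
  refine le_of_mul_le_mul_right ?_ hn2
  calc _ = (ε * n) ^ 4 * μ.real {x | (ε * n) ^ 4 ≤ (∑ i, g (x i)) ^ 4} := by ring
    _ ≤ κ * n + 3 * σ ^ 2 * (n : ℝ) ^ 2 := hmk.trans hS4le
    _ ≤ (κ + 3 * σ ^ 2) * (n : ℝ) ^ 2 := by nlinarith [mul_nonneg hκ0 (sub_nonneg.2 hnR)]

end EmpiricalMean

/-! ### Haar columns and Gaussian Gram–Schmidt -/

section HaarOrthogonal

open Matrix

/-- The group is closed in a finite-dimensional matrix space. This serves the uniqueness of Haar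
measure. -/
instance orthogonalGroup_locallyCompactSpace (N : ℕ) :
    LocallyCompactSpace (Matrix.orthogonalGroup (Fin N) ℝ) := by
  have : LocallyCompactSpace (Matrix (Fin N) (Fin N) ℝ) :=
    inferInstanceAs (LocallyCompactSpace (Fin N → Fin N → ℝ))
  have hc : IsClosed ((Matrix.orthogonalGroup (Fin N) ℝ : Set (Matrix (Fin N) (Fin N) ℝ))) := by
    have : (Matrix.orthogonalGroup (Fin N) ℝ : Set (Matrix (Fin N) (Fin N) ℝ)) =
        {A | A * star A = 1} := by
      ext A
      exact Matrix.mem_orthogonalGroup_iff (Fin N) ℝ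
    rw [this]
    exact isClosed_eq (by fun_prop) continuous_const
  exact hc.isClosedEmbedding_subtypeVal.locallyCompactSpace

theorem measurable_orthogonalGroup_apply {N : ℕ} (i j : Fin N) :
    Measurable fun O : Matrix.orthogonalGroup (Fin N) ℝ => O.1 i j :=
  (continuous_subtype_val.matrix_elem i j).measurable

theorem measurable_orthogonalGroup_mulVec {N : ℕ} {α : Type*} [MeasurableSpace α]
    {A : α → Matrix.orthogonalGroup (Fin N) ℝ} {v : α → Fin N → ℝ} (hA : Measurable A)
    (hv : Measurable v) : Measurable fun a => (A a).1 *ᵥ v a := by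
  refine measurable_pi_iff.2 fun i => ?_
  simp only [Matrix.mulVec, dotProduct]
  exact Finset.measurable_sum _ fun j _ =>
    ((measurable_orthogonalGroup_apply i j).comp hA).mul ((measurable_pi_apply j).comp hv)

/-- A Haar probability measure on the orthogonal group is right invariant. -/
theorem map_mul_right_eq_self_of_isHaarMeasure {N : ℕ}
    (ν : Measure (Matrix.orthogonalGroup (Fin N) ℝ)) [ν.IsHaarMeasure] [IsProbabilityMeasure ν]
    (V : Matrix.orthogonalGroup (Fin N) ℝ) : ν.map (· * V) = ν := by
  have hm : Measurable fun O : Matrix.orthogonalGroup (Fin N) ℝ => O * V :=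
    (continuous_mul_const V).measurable
  have : IsProbabilityMeasure (ν.map (· * V)) :=
    Measure.isProbabilityMeasure_map hm.aemeasurable
  -- Right translations commute with left ones, so the translated measure is again Haar, and
  -- uniqueness applies.
  exact Measure.isHaarMeasure_eq_of_isProbabilityMeasure _ _

theorem dotProduct_orthogonalGroup_mulVec {N : ℕ} (O : Matrix.orthogonalGroup (Fin N) ℝ)
    (v w : Fin N → ℝ) : (O.1 *ᵥ v) ⬝ᵥ (O.1 *ᵥ w) = v ⬝ᵥ w := by
  have h : O.1ᵀ * O.1 = 1 := (Matrix.mem_orthogonalGroup_iff' (Fin N) ℝ).1 O.2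
  rw [Matrix.dotProduct_mulVec, ← Matrix.mulVec_transpose, Matrix.mulVec_mulVec, h,
    Matrix.one_mulVec]

/-- The standard Gaussian measure on `ℝᴺ` is invariant under orthogonal matrices. -/
theorem measurePreserving_orthogonalGroup_mulVec_gaussian {N : ℕ}
    (O : Matrix.orthogonalGroup (Fin N) ℝ) :
    MeasurePreserving (fun v : Fin N → ℝ => O.1 *ᵥ v)
      (Measure.pi fun _ => gaussianReal 0 1) (Measure.pi fun _ => gaussianReal 0 1) := by
  have hmeas : Measurable fun v : Fin N → ℝ => O.1 *ᵥ v :=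
    measurable_orthogonalGroup_mulVec measurable_const measurable_id
  refine ⟨hmeas, ?_⟩
  let L : EuclideanSpace ℝ (Fin N) →ₗᵢ[ℝ] EuclideanSpace ℝ (Fin N) :=
    { toLinearMap := Matrix.toLpLin 2 2 O.1
      norm_map' := fun x => by
        have hx : Matrix.toLpLin 2 2 O.1 x = WithLp.toLp 2 (O.1 *ᵥ x.ofLp) := rfl
        rw [hx, ← sq_eq_sq₀ (norm_nonneg _) (norm_nonneg _), EuclideanSpace.real_norm_sq_eq,
          EuclideanSpace.real_norm_sq_eq]
        have := dotProduct_orthogonalGroup_mulVec O x.ofLp x.ofLp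
        simpa only [dotProduct, ← sq] using this }
  let e := L.toLinearIsometryEquiv rfl
  have he : ∀ v : Fin N → ℝ, e (WithLp.toLp 2 v) = WithLp.toLp 2 (O.1 *ᵥ v) := fun _ => rfl
  have key := stdGaussian_map e
  rw [← map_pi_eq_stdGaussian, Measure.map_map (by fun_prop) (by fun_prop)] at key
  have key2 := congrArg (Measure.map (WithLp.ofLp (p := 2) (V := Fin N → ℝ))) key
  rw [Measure.map_map (by fun_prop) (by fun_prop), Measure.map_map (by fun_prop) (by fun_prop)]
    at key2
  have h1 : (WithLp.ofLp (p := 2) (V := Fin N → ℝ)) ∘ (⇑e ∘ WithLp.toLp 2)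
      = fun v : Fin N → ℝ => O.1 *ᵥ v := by
    ext v : 1
    simp [he]
  have h2 : (WithLp.ofLp (p := 2) (V := Fin N → ℝ)) ∘ (WithLp.toLp 2) = id := rfl
  rw [h1, h2, Measure.map_id] at key2
  exact key2

/-- The normalization of a vector of `ℝᴺ` in the Euclidean norm. -/
noncomputable def euclideanNormalize {N : ℕ} (v : Fin N → ℝ) : Fin N → ℝ :=
  (√(v ⬝ᵥ v))⁻¹ • v

/-- The component of `h` orthogonal to `g`. -/
noncomputable def orthogonalComponent {N : ℕ} (g h : Fin N → ℝ) : Fin N → ℝ :=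
  h - ((g ⬝ᵥ h) / (g ⬝ᵥ g)) • g

/-- Gram–Schmidt is built from dot products, which orthogonal matrices preserve, so it commutes with
rotations. -/
theorem euclideanNormalize_mulVec {N : ℕ} (O : Matrix.orthogonalGroup (Fin N) ℝ)
    (v : Fin N → ℝ) : euclideanNormalize (O.1 *ᵥ v) = O.1 *ᵥ euclideanNormalize v := by
  simp only [euclideanNormalize, dotProduct_orthogonalGroup_mulVec, Matrix.mulVec_smul]

theorem orthogonalComponent_mulVec {N : ℕ} (O : Matrix.orthogonalGroup (Fin N) ℝ)
    (g h : Fin N → ℝ) :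
    orthogonalComponent (O.1 *ᵥ g) (O.1 *ᵥ h) = O.1 *ᵥ orthogonalComponent g h := by
  simp only [orthogonalComponent, dotProduct_orthogonalGroup_mulVec, Matrix.mulVec_smul,
    Matrix.mulVec_sub]

theorem euclideanNormalize_dotProduct_self {N : ℕ} {v : Fin N → ℝ} (hv : v ⬝ᵥ v ≠ 0) :
    euclideanNormalize v ⬝ᵥ euclideanNormalize v = 1 := by
  have h0 : 0 ≤ v ⬝ᵥ v := Finset.sum_nonneg fun i _ => mul_self_nonneg _
  have hs : √(v ⬝ᵥ v) * √(v ⬝ᵥ v) = v ⬝ᵥ v := Real.mul_self_sqrt h0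
  simp only [euclideanNormalize, smul_dotProduct, dotProduct_smul, smul_eq_mul]
  rw [← mul_assoc, ← mul_inv, hs, inv_mul_cancel₀ hv]

theorem euclideanNormalize_dotProduct_orthogonalComponent {N : ℕ} {g : Fin N → ℝ}
    (hg : g ⬝ᵥ g ≠ 0) (h : Fin N → ℝ) :
    euclideanNormalize g ⬝ᵥ euclideanNormalize (orthogonalComponent g h) = 0 := by
  have : g ⬝ᵥ orthogonalComponent g h = 0 := by
    simp only [orthogonalComponent, dotProduct_sub, dotProduct_smul, smul_eq_mul]
    field_simp
    ring
  rw [euclideanNormalize, euclideanNormalize, smul_dotProduct, dotProduct_smul, this]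
  simp

/-- Every orthonormal pair consists of the first two columns of an orthogonal matrix. -/
theorem exists_orthogonalGroup_col_eq {n : ℕ} {u v : Fin (n + 2) → ℝ} (hu : u ⬝ᵥ u = 1)
    (hv : v ⬝ᵥ v = 1) (huv : u ⬝ᵥ v = 0) :
    ∃ V : Matrix.orthogonalGroup (Fin (n + 2)) ℝ,
      (fun j => V.1 j 0) = u ∧ (fun j => V.1 j 1) = v := by
  let w : Fin (n + 2) → EuclideanSpace ℝ (Fin (n + 2)) :=
    fun i => if i = 0 then WithLp.toLp 2 u else WithLp.toLp 2 v
  have hw : Orthonormal ℝ (({0, 1} : Set (Fin (n + 2))).domRestrict w) := by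
    have hnorm : ∀ x : Fin (n + 2) → ℝ, x ⬝ᵥ x = 1 → ‖WithLp.toLp 2 x‖ = 1 := fun x hx => by
      rw [← sq_eq_sq₀ (norm_nonneg _) zero_le_one, EuclideanSpace.real_norm_sq_eq]
      simpa only [dotProduct, ← sq, one_pow] using hx
    refine ⟨?_, ?_⟩
    · rintro ⟨i, rfl | rfl⟩
      · simp [w, hnorm u hu]
      · simp [w, hnorm v hv]
    · rintro ⟨i, rfl | rfl⟩ ⟨j, rfl | rfl⟩ hij
      · exact absurd rfl hij
      · simp [w, EuclideanSpace.inner_toLp_toLp, huv, dotProduct_comm v u]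
      · simp [w, EuclideanSpace.inner_toLp_toLp, huv]
      · exact absurd rfl hij
  obtain ⟨b, hb⟩ := hw.exists_orthonormalBasis_extension_of_card_eq (by simp)
  refine ⟨⟨_, (EuclideanSpace.basisFun (Fin (n + 2)) ℝ).toMatrix_orthonormalBasis_mem_orthogonal b⟩,
    ?_, ?_⟩
  · ext j
    simp [Module.Basis.toMatrix_apply, hb 0 (by simp), w]
  · ext j
    simp [Module.Basis.toMatrix_apply, hb 1 (by simp), w]

/-- The law of the first two columns of a Haar distributed orthogonal matrix is dominated by that
of the Gram-Schmidt orthonormalization of a pair of independent Gaussian vectors. -/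
theorem haar_measure_columns_le {n : ℕ} (ν : Measure (Matrix.orthogonalGroup (Fin (n + 2)) ℝ))
    [ν.IsHaarMeasure] [IsProbabilityMeasure ν]
    {B : Set ((Fin (n + 2) → ℝ) × (Fin (n + 2) → ℝ))} (hB : MeasurableSet B) :
    ν {O | ((fun j => O.1 j 0), (fun j => O.1 j 1)) ∈ B} ≤
      ((Measure.pi fun _ : Fin (n + 2) => gaussianReal 0 1).prod
        (Measure.pi fun _ : Fin (n + 2) => gaussianReal 0 1))
        {p | p.1 ⬝ᵥ p.1 = 0 ∨
          orthogonalComponent p.1 p.2 ⬝ᵥ orthogonalComponent p.1 p.2 = 0 ∨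
          (euclideanNormalize p.1, euclideanNormalize (orthogonalComponent p.1 p.2)) ∈ B} := by
  set μ := ((Measure.pi fun _ : Fin (n + 2) => gaussianReal 0 1).prod
        (Measure.pi fun _ : Fin (n + 2) => gaussianReal 0 1)) with hμ
  set D : Set ((Fin (n + 2) → ℝ) × (Fin (n + 2) → ℝ)) := {p | p.1 ⬝ᵥ p.1 = 0 ∨
          orthogonalComponent p.1 p.2 ⬝ᵥ orthogonalComponent p.1 p.2 = 0 ∨
          (euclideanNormalize p.1, euclideanNormalize (orthogonalComponent p.1 p.2)) ∈ B} with hD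
  have mdot : ∀ {f g : (Fin (n + 2) → ℝ) × (Fin (n + 2) → ℝ) → (Fin (n + 2) → ℝ)},
      Measurable f → Measurable g → Measurable fun p => f p ⬝ᵥ g p := fun {f g} hf hg =>
    Finset.measurable_sum _ fun j _ =>
      ((measurable_pi_apply j).comp hf).mul ((measurable_pi_apply j).comp hg)
  have mnorm : ∀ {f : (Fin (n + 2) → ℝ) × (Fin (n + 2) → ℝ) → (Fin (n + 2) → ℝ)},
      Measurable f → Measurable fun p => euclideanNormalize (f p) := fun {f} hf =>
    (mdot hf hf).sqrt.inv.smul hf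
  have mcomp : Measurable fun p : (Fin (n + 2) → ℝ) × (Fin (n + 2) → ℝ) =>
      orthogonalComponent p.1 p.2 :=
    measurable_snd.sub (((mdot measurable_fst measurable_snd).div
      (mdot measurable_fst measurable_fst)).smul measurable_fst)
  have hDm : MeasurableSet D :=
    ((mdot measurable_fst measurable_fst) (measurableSet_singleton 0)).union
      (((mdot mcomp mcomp) (measurableSet_singleton 0)).union
        (((mnorm measurable_fst).prodMk (mnorm mcomp)) hB))
  let T : Matrix.orthogonalGroup (Fin (n + 2)) ℝ × ((Fin (n + 2) → ℝ) × (Fin (n + 2) → ℝ)) →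
      (Fin (n + 2) → ℝ) × (Fin (n + 2) → ℝ) := fun z => (z.1.1 *ᵥ z.2.1, z.1.1 *ᵥ z.2.2)
  have hT : Measurable T :=
    (measurable_orthogonalGroup_mulVec measurable_fst (measurable_fst.comp measurable_snd)).prodMk
      (measurable_orthogonalGroup_mulVec measurable_fst (measurable_snd.comp measurable_snd))
  -- Rotating the Gaussian pair by an independent Haar matrix `O` does not change its law.
  -- Integrating in the other order fixes the pair and leaves `O` random.
  have hleft : (ν.prod μ) (T ⁻¹' D) = μ D := by
    rw [Measure.prod_apply (hT hDm)]
    have : ∀ O, μ (Prod.mk O ⁻¹' (T ⁻¹' D)) = μ D := fun O =>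
      ((measurePreserving_orthogonalGroup_mulVec_gaussian O).prod
        (measurePreserving_orthogonalGroup_mulVec_gaussian O)).measure_preimage
        hDm.nullMeasurableSet
    simp [this]
  rw [← hleft, Measure.prod_apply_symm (hT hDm)]
  set b := ν {O | ((fun j => O.1 j 0), (fun j => O.1 j 1)) ∈ B} with hb
  have hconst : b = ∫⁻ _, b ∂μ := by simp
  rw [hconst]
  -- For a degenerate pair the inner probability is 1. Otherwise the orthonormalized pair forms the
  -- first two columns of some `V`, the rotated pair gives those of `O * V`, and right invariance
  -- applies.
  refine lintegral_mono fun p => ?_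
  by_cases h1 : p.1 ⬝ᵥ p.1 = 0
  · have : (fun O => (O, p)) ⁻¹' (T ⁻¹' D) = Set.univ := by
      refine Set.eq_univ_of_forall fun O => Or.inl ?_
      exact (dotProduct_orthogonalGroup_mulVec O p.1 p.1).trans h1
    rw [this, measure_univ]
    exact prob_le_one
  by_cases h2 : orthogonalComponent p.1 p.2 ⬝ᵥ orthogonalComponent p.1 p.2 = 0
  · have : (fun O => (O, p)) ⁻¹' (T ⁻¹' D) = Set.univ := by
      refine Set.eq_univ_of_forall fun O => Or.inr (Or.inl ?_)
      simp only [T]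
      rw [orthogonalComponent_mulVec, dotProduct_orthogonalGroup_mulVec, h2]
    rw [this, measure_univ]
    exact prob_le_one
  obtain ⟨V, hV1, hV2⟩ := exists_orthogonalGroup_col_eq (euclideanNormalize_dotProduct_self h1)
    (euclideanNormalize_dotProduct_self h2)
    (euclideanNormalize_dotProduct_orthogonalComponent h1 p.2)
  have hm : Measurable fun O : Matrix.orthogonalGroup (Fin (n + 2)) ℝ => O * V :=
    (continuous_mul_const V).measurable
  have hB' : MeasurableSet {O : Matrix.orthogonalGroup (Fin (n + 2)) ℝ |
      ((fun j => O.1 j 0), (fun j => O.1 j 1)) ∈ B} :=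
    ((measurable_pi_iff.2 fun j => measurable_orthogonalGroup_apply j 0).prodMk
      (measurable_pi_iff.2 fun j => measurable_orthogonalGroup_apply j 1)) hB
  rw [hb, ← map_mul_right_eq_self_of_isHaarMeasure ν V, Measure.map_apply hm hB',
    map_mul_right_eq_self_of_isHaarMeasure ν V]
  refine measure_mono fun O hO => ?_
  simp only [Set.mem_preimage, Set.mem_ofPred_eq, T, hD] at hO ⊢
  refine Or.inr (Or.inr ?_)
  rw [orthogonalComponent_mulVec, euclideanNormalize_mulVec, euclideanNormalize_mulVec, ← hV1,
    ← hV2]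
  exact hO

end HaarOrthogonal

/-! ### The ratio as a function of empirical moments -/

section MomentExpansion

/-- The expansion of the mean of `(c₁ y² + c₂ x y + c₃ x²) ^ q` in terms of the mixed moments
`A (a, b)`, standing for the mean of `x ^ a * y ^ b`. -/
noncomputable def quadraticPowerMean (q : ℕ) (c₁ c₂ c₃ : ℝ) (A : ℕ × ℕ → ℝ) : ℝ :=
  ∑ i ∈ Finset.range (q + 1), ∑ k ∈ Finset.range (i + 1),
    (c₁ ^ k * c₂ ^ (i - k) * c₃ ^ (q - i) * (i.choose k : ℝ) * (q.choose i : ℝ)) *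
      A (i - k + 2 * (q - i), 2 * k + (i - k))

/-- Two nested binomial expansions: `k` factors `c₁ y²`, `i - k` factors `c₂ x y` and `q - i`
factors `c₃ x²`. -/
theorem pow_eq_quadraticPowerMean (q : ℕ) (c₁ c₂ c₃ x y : ℝ) :
    (c₁ * y ^ 2 + c₂ * (x * y) + c₃ * x ^ 2) ^ q =
      quadraticPowerMean q c₁ c₂ c₃ (fun d => x ^ d.1 * y ^ d.2) := by
  rw [add_pow, quadraticPowerMean]
  refine Finset.sum_congr rfl fun i _ => ?_
  rw [add_pow, Finset.sum_mul, Finset.sum_mul]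
  refine Finset.sum_congr rfl fun k _ => ?_
  simp only [mul_pow, pow_add, pow_mul]
  ring

theorem mean_pow_eq_quadraticPowerMean {N : ℕ} (q : ℕ) (c₁ c₂ c₃ : ℝ) (g h : Fin N → ℝ) :
    (∑ j, (c₁ * h j ^ 2 + c₂ * (g j * h j) + c₃ * g j ^ 2) ^ q) / N =
      quadraticPowerMean q c₁ c₂ c₃ (fun d => (∑ j, g j ^ d.1 * h j ^ d.2) / N) := by
  simp_rw [pow_eq_quadraticPowerMean, quadraticPowerMean]
  rw [Finset.sum_comm, Finset.sum_div]
  refine Finset.sum_congr rfl fun i _ => ?_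
  rw [Finset.sum_comm, Finset.sum_div]
  refine Finset.sum_congr rfl fun k _ => ?_
  rw [← Finset.mul_sum, mul_div_assoc]

theorem integral_pow_eq_quadraticPowerMean {μ : Measure (ℝ × ℝ)}
    (hμ : ∀ a b : ℕ, Integrable (fun z => z.1 ^ a * z.2 ^ b) μ) (q : ℕ) (c₁ c₂ c₃ : ℝ) :
    Integrable (fun z => (c₁ * z.2 ^ 2 + c₂ * (z.1 * z.2) + c₃ * z.1 ^ 2) ^ q) μ ∧
    ∫ z, (c₁ * z.2 ^ 2 + c₂ * (z.1 * z.2) + c₃ * z.1 ^ 2) ^ q ∂μ =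
      quadraticPowerMean q c₁ c₂ c₃ (fun d => ∫ z, z.1 ^ d.1 * z.2 ^ d.2 ∂μ) := by
  simp_rw [pow_eq_quadraticPowerMean, quadraticPowerMean]
  have hi : ∀ i ∈ Finset.range (q + 1), Integrable (fun z : ℝ × ℝ =>
      ∑ k ∈ Finset.range (i + 1),
        (c₁ ^ k * c₂ ^ (i - k) * c₃ ^ (q - i) * (i.choose k : ℝ) * (q.choose i : ℝ)) *
          (z.1 ^ (i - k + 2 * (q - i)) * z.2 ^ (2 * k + (i - k)))) μ :=
    fun i _ => integrable_finsetSum _ fun k _ => (hμ _ _).const_mul _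
  refine ⟨integrable_finsetSum _ hi, ?_⟩
  rw [integral_finsetSum _ hi]
  refine Finset.sum_congr rfl fun i _ => ?_
  rw [integral_finsetSum _ fun k _ => (hμ _ _).const_mul _]
  exact Finset.sum_congr rfl fun k _ => integral_const_mul _ _

theorem continuousAt_quadraticPowerMean {α : Type*} [TopologicalSpace α] (q : ℕ)
    {c₁ c₂ c₃ : α → ℝ} {A : α → ℕ × ℕ → ℝ} {a : α} (h₁ : ContinuousAt c₁ a)
    (h₂ : ContinuousAt c₂ a) (h₃ : ContinuousAt c₃ a) (hA : ContinuousAt A a) :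
    ContinuousAt (fun x => quadraticPowerMean q (c₁ x) (c₂ x) (c₃ x) (A x)) a := by
  unfold quadraticPowerMean
  refine tendsto_finsetSum _ fun i _ => tendsto_finsetSum _ fun k _ => ?_
  exact (((((h₁.pow k).mul (h₂.pow _)).mul (h₃.pow _)).mul continuousAt_const).mul
    continuousAt_const).mul ((continuous_apply _).continuousAt.tendsto.comp hA)

/-- The variance of the second variable after removal of its projection on the first one, as a
function of the mixed moments. -/
noncomputable def residualMoment (A : ℕ × ℕ → ℝ) : ℝ :=
  A (0, 2) - 2 * (A (1, 1) / A (2, 0)) * A (1, 1) + (A (1, 1) / A (2, 0)) ^ 2 * A (2, 0)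

/-- The mean of `(t² v² + s² u²) ^ q`, where `(u, v)` is the orthonormalization of a pair with
mixed moments `A`. -/
noncomputable def orthonormalizedMean (q : ℕ) (s t : ℝ) (A : ℕ × ℕ → ℝ) : ℝ :=
  quadraticPowerMean q (t ^ 2 / residualMoment A)
    (-2 * t ^ 2 * (A (1, 1) / A (2, 0)) / residualMoment A)
    (t ^ 2 * (A (1, 1) / A (2, 0)) ^ 2 / residualMoment A + s ^ 2 / A (2, 0)) A

theorem continuousAt_residualMoment {A : ℕ × ℕ → ℝ} (hA : A (2, 0) ≠ 0) :
    ContinuousAt residualMoment A := by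
  have e : ∀ d : ℕ × ℕ, ContinuousAt (fun A : ℕ × ℕ → ℝ => A d) A := fun d =>
    (continuous_apply d).continuousAt
  have hβ : ContinuousAt (fun A : ℕ × ℕ → ℝ => A (1, 1) / A (2, 0)) A := (e _).div (e _) hA
  exact ((e _).sub ((hβ.const_mul 2).mul (e _))).add ((hβ.pow 2).mul (e _))

/-- Only finitely many moments occur, so the product topology suffices; the two denominators are the
only obstruction. -/
theorem continuousAt_orthonormalizedMean (q : ℕ) (s t : ℝ) {A : ℕ × ℕ → ℝ} (hA : A (2, 0) ≠ 0)
    (hr : residualMoment A ≠ 0) : ContinuousAt (orthonormalizedMean q s t) A := by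
  have e : ∀ d : ℕ × ℕ, ContinuousAt (fun A : ℕ × ℕ → ℝ => A d) A := fun d =>
    (continuous_apply d).continuousAt
  have hβ : ContinuousAt (fun A : ℕ × ℕ → ℝ => A (1, 1) / A (2, 0)) A := (e _).div (e _) hA
  have hR := continuousAt_residualMoment hA
  have h1 : ContinuousAt (fun A : ℕ × ℕ → ℝ => t ^ 2 / residualMoment A) A :=
    continuousAt_const.div hR hr
  have h2 : ContinuousAt (fun A : ℕ × ℕ → ℝ =>
      -2 * t ^ 2 * (A (1, 1) / A (2, 0)) / residualMoment A) A :=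
    (hβ.const_mul _).div hR hr
  have h3 : ContinuousAt (fun A : ℕ × ℕ → ℝ =>
      t ^ 2 * (A (1, 1) / A (2, 0)) ^ 2 / residualMoment A + s ^ 2 / A (2, 0)) A :=
    (((hβ.pow 2).const_mul _).div hR hr).add (continuousAt_const.div (e _) hA)
  unfold orthonormalizedMean
  exact continuousAt_quadraticPowerMean q h1 h2 h3 continuousAt_id

/-- The empirical mixed moments of the coordinates of a pair of vectors. -/
noncomputable def empiricalMoment {N : ℕ} (p : (Fin N → ℝ) × (Fin N → ℝ)) (d : ℕ × ℕ) : ℝ :=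
  (∑ j, p.1 j ^ d.1 * p.2 j ^ d.2) / N

open Matrix

theorem dotProduct_self_eq_empiricalMoment {N : ℕ} (hN : 0 < N) (g h : Fin N → ℝ) :
    g ⬝ᵥ g = N * empiricalMoment (g, h) (2, 0) := by
  have : (N : ℝ) ≠ 0 := by positivity
  simp only [empiricalMoment, dotProduct, pow_zero, mul_one, sq]
  field_simp

theorem dotProduct_eq_empiricalMoment {N : ℕ} (hN : 0 < N) (g h : Fin N → ℝ) :
    g ⬝ᵥ h = N * empiricalMoment (g, h) (1, 1) := by
  have : (N : ℝ) ≠ 0 := by positivity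
  simp only [empiricalMoment, dotProduct, pow_one]
  field_simp

theorem orthogonalComponent_dotProduct_self {N : ℕ} (hN : 0 < N) (g h : Fin N → ℝ) :
    orthogonalComponent g h ⬝ᵥ orthogonalComponent g h
      = N * residualMoment (empiricalMoment (g, h)) := by
  have hN' : (N : ℝ) ≠ 0 := by positivity
  have h2 : h ⬝ᵥ h = N * empiricalMoment (g, h) (0, 2) := by
    simp only [empiricalMoment, dotProduct, pow_zero, one_mul, sq]
    field_simp
  simp only [orthogonalComponent, sub_dotProduct, dotProduct_sub, smul_dotProduct,
    dotProduct_smul, smul_eq_mul, dotProduct_comm h g, residualMoment]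
  rw [h2, dotProduct_self_eq_empiricalMoment hN g h, dotProduct_eq_empiricalMoment hN g h,
    mul_div_mul_left _ _ hN']
  ring

/-- The normalized `q`-th moment sum whose value on the first two columns of an orthogonal matrix
is the inverse participation ratio. -/
noncomputable def columnMoment {N : ℕ} (q : ℕ) (s t : ℝ) (p : (Fin N → ℝ) × (Fin N → ℝ)) : ℝ :=
  (N : ℝ) ^ (q - 1) * ∑ j, (t ^ 2 * p.2 j ^ 2 + s ^ 2 * p.1 j ^ 2) ^ q

/-- Both squared norms are `N` times a moment expression, so each summand carries `N⁻¹` to the power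
`q`; against `N ^ (q - 1)` this leaves the `1 / N` of an empirical mean. -/
theorem columnMoment_orthonormalize {N : ℕ} (hN : 0 < N) {q : ℕ} (hq : 1 ≤ q) (s t : ℝ)
    (g h : Fin N → ℝ) (hg : empiricalMoment (g, h) (2, 0) ≠ 0)
    (hr : residualMoment (empiricalMoment (g, h)) ≠ 0) :
    columnMoment q s t (euclideanNormalize g, euclideanNormalize (orthogonalComponent g h)) =
      orthonormalizedMean q s t (empiricalMoment (g, h)) := by
  have hN' : (N : ℝ) ≠ 0 := by positivity
  have hsq : ∀ (v : Fin N → ℝ) j, euclideanNormalize v j ^ 2 = v j ^ 2 / (v ⬝ᵥ v) := fun v j => by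
    have h0 : 0 ≤ v ⬝ᵥ v := Finset.sum_nonneg fun i _ => mul_self_nonneg _
    simp only [euclideanNormalize, Pi.smul_apply, smul_eq_mul]
    rw [mul_pow, inv_pow, Real.sq_sqrt h0]
    ring
  unfold orthonormalizedMean
  have := mean_pow_eq_quadraticPowerMean q
    (t ^ 2 / residualMoment (empiricalMoment (g, h)))
    (-2 * t ^ 2 * (empiricalMoment (g, h) (1, 1) / empiricalMoment (g, h) (2, 0)) /
      residualMoment (empiricalMoment (g, h)))
    (t ^ 2 * (empiricalMoment (g, h) (1, 1) / empiricalMoment (g, h) (2, 0)) ^ 2 /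
      residualMoment (empiricalMoment (g, h)) + s ^ 2 / empiricalMoment (g, h) (2, 0)) g h
  refine Eq.trans ?_ this
  rw [columnMoment, Finset.mul_sum, Finset.sum_div]
  refine Finset.sum_congr rfl fun j _ => ?_
  have hpow : (N : ℝ) ^ (q - 1) = (N : ℝ) ^ q / N := by
    rw [eq_div_iff hN', ← pow_succ, Nat.sub_add_cancel hq]
  rw [hpow, div_mul_eq_mul_div, ← mul_pow]
  simp only [hsq]
  rw [orthogonalComponent_dotProduct_self hN, dotProduct_self_eq_empiricalMoment hN g h]
  simp only [orthogonalComponent, Pi.sub_apply, Pi.smul_apply, smul_eq_mul]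
  rw [dotProduct_self_eq_empiricalMoment hN g h, dotProduct_eq_empiricalMoment hN g h,
    mul_div_mul_left _ _ hN']
  congr 2
  field_simp
  ring

end MomentExpansion

/-! ### Gaussian moments and their concentration -/

section GaussianMoments

theorem integrable_pow_mul_pow_gaussian_prod (a b : ℕ) :
    Integrable (fun z : ℝ × ℝ => z.1 ^ a * z.2 ^ b)
      ((gaussianReal 0 1).prod (gaussianReal 0 1)) := by
  have h : ∀ a : ℕ, Integrable (fun x : ℝ => x ^ a) (gaussianReal 0 1) := fun a => by
    rcases eq_or_ne a 0 with rfl | ha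
    · simp
    · refine ((memLp_id_gaussianReal' (μ := 0) (v := 1) (a : ℝ≥0∞)
        (by simp)).integrable_norm_pow ha).mono (by fun_prop) (ae_of_all _ fun x => ?_)
      simp
  exact (h a).mul_prod (h b)

/-- The mixed moments of a pair of independent standard Gaussian variables. -/
noncomputable def gaussianMoment (d : ℕ × ℕ) : ℝ :=
  ∫ z : ℝ × ℝ, z.1 ^ d.1 * z.2 ^ d.2 ∂((gaussianReal 0 1).prod (gaussianReal 0 1))

theorem gaussianMoment_eq_mul (d : ℕ × ℕ) : gaussianMoment d =
    (∫ x, x ^ d.1 ∂(gaussianReal 0 1)) * ∫ x, x ^ d.2 ∂(gaussianReal 0 1) :=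
  integral_prod_mul (fun x : ℝ => x ^ d.1) (fun x : ℝ => x ^ d.2)

theorem integral_sq_gaussianReal : ∫ x : ℝ, x ^ 2 ∂(gaussianReal 0 1) = 1 := by
  have h := variance_id_gaussianReal (μ := 0) (v := 1)
  rw [variance_of_integral_eq_zero aemeasurable_id (by simp)] at h
  simpa using h

theorem gaussianMoment_two_zero : gaussianMoment (2, 0) = 1 := by
  simp [gaussianMoment_eq_mul, integral_sq_gaussianReal]

theorem gaussianMoment_one_one : gaussianMoment (1, 1) = 0 := by
  simp [gaussianMoment_eq_mul]

theorem residualMoment_gaussianMoment : residualMoment gaussianMoment = 1 := by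
  have : gaussianMoment (0, 2) = 1 := by
    simp [gaussianMoment_eq_mul, integral_sq_gaussianReal]
  simp [residualMoment, gaussianMoment_one_one, this]

/-- At the Gaussian moments the projection coefficient is 0 and both variances are 1, so the
quadratic form reduces to `t² y² + s² x²`. -/
theorem orthonormalizedMean_gaussianMoment (q : ℕ) (s t : ℝ) :
    orthonormalizedMean q s t gaussianMoment =
      ∫ z : ℝ × ℝ, (t ^ 2 * z.2 ^ 2 + s ^ 2 * z.1 ^ 2) ^ q
        ∂((gaussianReal 0 1).prod (gaussianReal 0 1)) := by
  have := (integral_pow_eq_quadraticPowerMean integrable_pow_mul_pow_gaussian_prod q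
    (t ^ 2) 0 (s ^ 2)).2
  simp only [zero_mul, add_zero] at this
  rw [this]
  simp only [orthonormalizedMean, residualMoment_gaussianMoment, gaussianMoment_one_one,
    gaussianMoment_two_zero]
  norm_num
  rfl

/-- The empirical mixed moments of Gaussian vectors concentrate around the Gaussian moments, with
summable deviation probabilities. -/
theorem tsum_measure_empiricalMoment_notMem_ne_top {U : Set (ℕ × ℕ → ℝ)}
    (hU : U ∈ 𝓝 gaussianMoment) :
    ∑' n : ℕ, ((Measure.pi fun _ : Fin (n + 2) => gaussianReal 0 1).prod
        (Measure.pi fun _ : Fin (n + 2) => gaussianReal 0 1)) {p | empiricalMoment p ∉ U} ≠ ∞ := by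
  -- A neighbourhood in the product topology constrains only finitely many moments, so a finite
  -- union bound suffices.
  rw [nhds_pi, Filter.mem_pi] at hU
  obtain ⟨I, hI, T, hT, hTU⟩ := hU
  have hball : ∀ d, ∃ ε > 0, Metric.ball (gaussianMoment d) ε ⊆ T d := fun d =>
    Metric.mem_nhds_iff.1 (hT d)
  choose ε hε hεT using hball
  have hdev : ∀ d : ℕ × ℕ, ∃ C : ℝ, ∀ n : ℕ, 0 < n →
      ((Measure.pi fun _ : Fin n => gaussianReal 0 1).prod
        (Measure.pi fun _ : Fin n => gaussianReal 0 1))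
        {p | ε d ≤ |empiricalMoment p d - gaussianMoment d|} ≤
          ENNReal.ofReal (C / (n : ℝ) ^ 2) := fun d => by
    obtain ⟨C, hC⟩ := exists_measure_empiricalMean_deviation_le
      (ρ := (gaussianReal 0 1).prod (gaussianReal 0 1))
      (f := fun z : ℝ × ℝ => z.1 ^ d.1 * z.2 ^ d.2) (by fun_prop)
      (by simpa only [mul_pow, ← pow_mul] using
        integrable_pow_mul_pow_gaussian_prod (d.1 * 4) (d.2 * 4)) (hε d)
    refine ⟨C, fun n hn => ?_⟩
    -- A pair of Gaussian vectors is regrouped as `n` independent Gaussian pairs.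
    rw [← (measurePreserving_arrowProdEquivProdArrow ℝ ℝ (Fin n) (fun _ => gaussianReal 0 1)
      (fun _ => gaussianReal 0 1)).measure_preimage_equiv]
    exact hC n hn
  choose C hC using hdev
  refine ne_top_of_le_ne_top (b := ∑' n : ℕ, ∑ d ∈ hI.toFinset,
    ENNReal.ofReal (C d / ((n + 2 : ℕ) : ℝ) ^ 2)) ?_ (ENNReal.tsum_le_tsum fun n => ?_)
  · rw [Summable.tsum_finsetSum fun _ _ => ENNReal.summable]
    refine ENNReal.sum_ne_top.2 fun d _ => ?_
    refine Summable.tsum_ofReal_ne_top ?_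
    have := (summable_nat_add_iff 2).2 (Real.summable_one_div_nat_pow.2 one_lt_two)
    simpa [div_eq_mul_inv] using this.mul_left (C d)
  · refine le_trans (measure_mono fun p hp => ?_) ((measure_biUnion_finset_le hI.toFinset
      (fun d => {p | ε d ≤ |empiricalMoment p d - gaussianMoment d|})).trans
      (Finset.sum_le_sum fun d _ => hC d (n + 2) (by simp)))
    by_contra hcon
    refine hp (hTU fun d hd => hεT d ?_)
    simp only [Set.mem_iUnion, not_exists] at hcon
    have := hcon d (hI.mem_toFinset.2 hd)
    simpa [Real.dist_eq] using this

end GaussianMoments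

/-! ### Deviation of the ratio under Haar measure -/

section InverseParticipationRatio

open Matrix

theorem norm_sq_ofReal_mul_add_I_mul (s t x y : ℝ) :
    ‖(t : ℂ) * (x : ℂ) + Complex.I * (s : ℂ) * (y : ℂ)‖ ^ 2 = t ^ 2 * x ^ 2 + s ^ 2 * y ^ 2 := by
  rw [Complex.sq_norm, Complex.normSq_apply]
  simp
  ring

theorem inverseParticipationRatio_columnCombination {n : ℕ} {q : ℕ} (hq : 1 ≤ q) {s t : ℝ}
    (hst : t ^ 2 + s ^ 2 = 1) (O : Matrix.orthogonalGroup (Fin (n + 2)) ℝ) :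
    inverseParticipationRatio q (columnCombination s t O) =
      columnMoment q s t ((fun j => O.1 j 0), (fun j => O.1 j 1)) := by
  have hcol : ∀ k, ∑ j, O.1 j k ^ 2 = 1 := fun k => by
    have h : O.1ᵀ * O.1 = 1 := (Matrix.mem_orthogonalGroup_iff' _ ℝ).1 O.2
    have := congrFun (congrFun h k) k
    simpa [Matrix.mul_apply, ← sq] using this
  have h2 : ‖WithLp.toLp (2 : ℝ≥0∞) (columnCombination s t O)‖ ^ 2 = 1 := by
    rw [PiLp.norm_sq_eq_of_L2]
    simp only [columnCombination, norm_sq_ofReal_mul_add_I_mul, Finset.sum_add_distrib,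
      ← Finset.mul_sum, hcol, mul_one, hst]
  have hp : ‖WithLp.toLp ((2 * q : ℕ) : ℝ≥0∞) (columnCombination s t O)‖ ^ (2 * q) =
      ∑ j, ‖columnCombination s t O j‖ ^ (2 * q) := by
    have hpos : 0 < (((2 * q : ℕ) : ℝ≥0∞)).toReal := by
      rw [ENNReal.toReal_natCast]
      exact_mod_cast (by omega : 0 < 2 * q)
    rw [PiLp.norm_eq_sum hpos, ENNReal.toReal_natCast, ← Real.rpow_natCast, ← Real.rpow_mul
      (Finset.sum_nonneg fun _ _ => by positivity), one_div_mul_cancel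
      (by exact_mod_cast (by omega : 2 * q ≠ 0)), Real.rpow_one]
    simp only [Real.rpow_natCast]
  rw [inverseParticipationRatio, hp, pow_mul ‖WithLp.toLp 2 _‖, h2, one_pow, div_one,
    columnMoment]
  simp only [pow_mul, columnCombination, norm_sq_ofReal_mul_add_I_mul]

theorem tsum_haar_columnMoment_deviation_ne_top
    (ν : (n : ℕ) → Measure (Matrix.orthogonalGroup (Fin (n + 2)) ℝ))
    [∀ n, (ν n).IsHaarMeasure] [∀ n, IsProbabilityMeasure (ν n)] {q : ℕ} (hq : 1 ≤ q) (s t : ℝ)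
    {ε : ℝ} (hε : 0 < ε) :
    ∑' n, ν n {O | ε ≤ |columnMoment q s t ((fun j => O.1 j 0), (fun j => O.1 j 1)) -
      orthonormalizedMean q s t gaussianMoment|} ≠ ∞ := by
  have h20 : gaussianMoment (2, 0) ≠ 0 := by simp [gaussianMoment_two_zero]
  have hr : residualMoment gaussianMoment ≠ 0 := by simp [residualMoment_gaussianMoment]
  -- The two nonvanishing conditions make this neighbourhood exclude the degenerate pairs as well.
  have hU : {A : ℕ × ℕ → ℝ | A (2, 0) ≠ 0 ∧ residualMoment A ≠ 0 ∧
      |orthonormalizedMean q s t A - orthonormalizedMean q s t gaussianMoment| < ε} ∈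
      𝓝 gaussianMoment := by
    filter_upwards [(continuous_apply (2, 0)).continuousAt.eventually_ne h20,
      (continuousAt_residualMoment h20).eventually_ne hr,
      (continuousAt_orthonormalizedMean q s t h20 hr).eventually
        (Metric.ball_mem_nhds _ hε)] with A h1 h2 h3
    exact ⟨h1, h2, h3⟩
  refine ne_top_of_le_ne_top (tsum_measure_empiricalMoment_notMem_ne_top hU)
    (ENNReal.tsum_le_tsum fun n => ?_)
  have hB : MeasurableSet {p : (Fin (n + 2) → ℝ) × (Fin (n + 2) → ℝ) |
      ε ≤ |columnMoment q s t p - orthonormalizedMean q s t gaussianMoment|} := by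
    refine measurableSet_le measurable_const ?_
    unfold columnMoment
    fun_prop
  refine (haar_measure_columns_le (ν n) hB).trans (measure_mono ?_)
  have hN : ((n + 2 : ℕ) : ℝ) ≠ 0 := by positivity
  rintro ⟨g, h⟩ hp ⟨h1, h2, h3⟩
  rcases hp with hp | hp | hp
  · rw [dotProduct_self_eq_empiricalMoment (by simp) g h] at hp
    exact (mul_ne_zero hN h1) hp
  · rw [orthogonalComponent_dotProduct_self (by simp)] at hp
    exact (mul_ne_zero hN h2) hp
  · simp only [Set.mem_ofPred_eq] at hp
    rw [columnMoment_orthonormalize (by simp) hq s t g h h1 h2] at hp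
    exact absurd h3 (not_lt.2 hp)

end InverseParticipationRatio

/-! ### Almost sure convergence -/

theorem corollary7p4
    {Ω : Type*} [MeasurableSpace Ω] (P : Measure Ω) [IsProbabilityMeasure P]
    (O : (n : ℕ) → Ω → Matrix.orthogonalGroup (Fin (n + 2)) ℝ)
    (hO : ∀ n, IsHaarOrthogonal P (O n))
    {Ω' : Type*} [MeasurableSpace Ω'] (P' : Measure Ω') [IsProbabilityMeasure P']
    (X Y : Ω' → ℝ) (hX : HasLaw X (gaussianReal 0 1) P') (hY : HasLaw Y (gaussianReal 0 1) P')
    (hXY : IndepFun X Y P')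
    (q : ℕ) (hq : 1 ≤ q) (s t : ℝ) (hst : t ^ 2 + s ^ 2 = 1) :
    Integrable (fun ω' => ‖(t : ℂ) * (X ω' : ℂ) + Complex.I * (s : ℂ) * (Y ω' : ℂ)‖ ^ (2 * q)) P' ∧
    ∀ᵐ ω ∂P, Tendsto
      (fun n : ℕ => inverseParticipationRatio q (columnCombination s t (O n ω)))
      atTop
      (𝓝 (∫ ω', ‖(t : ℂ) * (X ω' : ℂ) + Complex.I * (s : ℂ) * (Y ω' : ℂ)‖ ^ (2 * q) ∂P')) := by
  -- `Y` comes first because it corresponds to `O₁`, the first vector of the Gram–Schmidt pair.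
  have hYX : P'.map (fun ω => (Y ω, X ω)) = (gaussianReal 0 1).prod (gaussianReal 0 1) := by
    rw [(indepFun_iff_map_prod_eq_prod_map_map hY.aemeasurable hX.aemeasurable).1 hXY.symm,
      hX.map_eq, hY.map_eq]
  have hYXm : AEMeasurable (fun ω => (Y ω, X ω)) P' := hY.aemeasurable.prodMk hX.aemeasurable
  have hint := (integral_pow_eq_quadraticPowerMean integrable_pow_mul_pow_gaussian_prod q
    (t ^ 2) 0 (s ^ 2)).1
  simp only [zero_mul, add_zero] at hint
  simp_rw [pow_mul, norm_sq_ofReal_mul_add_I_mul]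
  refine ⟨?_, ?_⟩
  · rw [← hYX] at hint
    exact hint.comp_aemeasurable hYXm
  have hlim : ∫ ω', (t ^ 2 * X ω' ^ 2 + s ^ 2 * Y ω' ^ 2) ^ q ∂P' =
      orthonormalizedMean q s t gaussianMoment := by
    rw [orthonormalizedMean_gaussianMoment, ← hYX, integral_map hYXm (by fun_prop)]
  rw [hlim]
  simp_rw [inverseParticipationRatio_columnCombination hq hst]
  have := fun n => (hO n).isHaarMeasure
  have hprob : ∀ n, IsProbabilityMeasure (P.map (O n)) := fun n =>
    Measure.isProbabilityMeasure_map (hO n).aemeasurable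
  -- Borel–Cantelli at each tolerance `1 / (k + 1)`; countably many tolerances then allow one common
  -- null set.
  have hae : ∀ k : ℕ, ∀ᵐ ω ∂P, ∀ᶠ n in atTop,
      |columnMoment q s t ((fun j => (O n ω).1 j 0), (fun j => (O n ω).1 j 1)) -
        orthonormalizedMean q s t gaussianMoment| < 1 / ((k : ℝ) + 1) := fun k => by
    have hsum := tsum_haar_columnMoment_deviation_ne_top (fun n => P.map (O n)) hq s t
      (Nat.one_div_pos_of_nat (α := ℝ) (n := k))
    have hle := ae_eventually_notMem (μ := P) (s := fun n => O n ⁻¹' {A |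
      1 / ((k : ℝ) + 1) ≤ |columnMoment q s t ((fun j => A.1 j 0), (fun j => A.1 j 1)) -
        orthonormalizedMean q s t gaussianMoment|})
      (ne_top_of_le_ne_top hsum (ENNReal.tsum_le_tsum fun n =>
        Measure.le_map_apply (hO n).aemeasurable _))
    filter_upwards [hle] with ω hω
    filter_upwards [hω] with n hn
    exact not_le.1 hn
  filter_upwards [ae_all_iff.2 hae] with ω hω
  rw [Metric.tendsto_atTop']
  intro ε hε
  obtain ⟨k, hk⟩ := exists_nat_one_div_lt hε
  obtain ⟨M, hM⟩ := eventually_atTop.1 (hω k)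
  exact ⟨M, fun n hn => (hM n hn.le).trans hk⟩
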